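/- A signed hypergraph $H=(V,S)$ consists of a finite node set $V$ and a finite set $S$ of signed edges; a signed edge $s=(e,\eta_s)$ consists of a set $e\subseteq V$ with $|e|\ge 2$ and a map $\eta_s:e\to\{-1,+1\}$ (we write $v\in s$ for $v\in e$ and $|s|$ for $|e|$). Put $\sigma_s(z_v)=z_v$ if $\eta_s(v)=+1$ and $\sigma_s(z_v)=1-z_v$ if $\eta_s(v)=-1$. The pseudo-Boolean polytope $\mathrm{PBP}(H)$ is the convex hull of $$\Big\{z\in\{0,1\}^{V\cup S}:\ z_s=\prod_{v\in s}\sigma_s(z_v)\ \text{ for all } s\in S\Big\}.$$ An extended formulation of $\mathrm{PBP}(H)$ is a finite system of linear inequalities $Az+By\le b$ in the variables $z\in\mathbb{R}^{V\cup S}$ and finitely many additional variables $y$, such that $\mathrm{PBP}(H)=\{z:\ \exists y,\ Az+By\le b\}$. Its variables are all the components of $z$ and $y$. **Proposition.** (1) There is an absolute constant $C$ such that the following holds. Let $H=(V,S)$ be a signed hypergraph with $S\neq\emptyset$ and let $k\ge 0$ be an integer such that every $s\in S$ satisfies $|s|\ge |V|-k$. Then $\mathrm{PBP}(H)$ has an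 extended formulation with at most $C\,2^k|V||S|$ variables and at most $C\,2^k|V||S|$ inequalities, in which all coefficients and right-hand side constants belong to $\{0,1,-1\}$. (2) In particular, if $k=O(\log \mathrm{poly}(|V|,|S|))$, then $\mathrm{PBP}(H)$ has a polynomial-size extended formulation with such data. That is, for every polynomial $p$ in two variables with nonnegative integer coefficients and every real $c$ there is a polynomial $q$ in two variables with nonnegative integer coefficients such that the following holds. Let $H=(V,S)$ be a signed hypergraph ($S=\emptyset$ allowed) and let $k\ge 0$ be an integer with $k\le c\log p(|V|,|S|)$ (with the convention $\log 0=0$) such that every $s\in S$ satisfies $|s|\ge |V|-k$. Then $\mathrm{PBP}(H)$ has an extended formulation with at most $q(|V|,|S|)$ variables and at most $q(|V|,|S|)$ inequalities, in which all coefficients and right-hand side constants belong to $\{0,1,-1\}$. -/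

import Mathlib

open scoped Matrix

universe u

/-- A signed edge on the node set `V`: a set of at least two nodes, together with a sign
(`1` or `-1`) for each of its nodes. -/
structure SignedEdge (V : Type u) where
  nodes : Finset V
  two_le_card : 2 ≤ nodes.card
  sign : nodes → ℤˣ

/-- A signed hypergraph on the (finite) node set `V`. Its signed edges form a finite set, so that
there are no two identical ones; parallel ones are allowed. -/
structure SignedHypergraph (V : Type u) where
  edges : Finset (SignedEdge V)

/-- `z` if the sign is `+1`, and `1 - z` if the sign is `-1`. -/
noncomputable def signedValue (η : ℤˣ) (z : ℝ) : ℝ :=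
  if η = 1 then z else 1 - z

/-- The coordinates of the pseudo-Boolean set: one for each node and one for each signed edge. -/
abbrev SignedHypergraph.Coord {V : Type u} (H : SignedHypergraph V) : Type u :=
  V ⊕ H.edges

/-- The pseudo-Boolean set of `H`. -/
def SignedHypergraph.pseudoBooleanSet {V : Type u} (H : SignedHypergraph V) :
    Set (H.Coord → ℝ) :=
  {z | (∀ i, z i = 0 ∨ z i = 1) ∧
    ∀ s : H.edges, z (Sum.inr s) =
      ∏ v : s.1.nodes, signedValue (s.1.sign v) (z (Sum.inl v.1))}

/-- The pseudo-Boolean polytope of `H`. -/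
def SignedHypergraph.pseudoBooleanPolytope {V : Type u} (H : SignedHypergraph V) :
    Set (H.Coord → ℝ) :=
  convexHull ℝ H.pseudoBooleanSet

/-- A finite system of linear inequalities `A x + B y ≤ b` in the original variables `x`, indexed
by `ι`, and finitely many additional variables `y`. -/
structure LiftedSystem (ι : Type u) where
  numAux : ℕ
  numIneqs : ℕ
  A : Matrix (Fin numIneqs) ι ℝ
  B : Matrix (Fin numIneqs) (Fin numAux) ℝ
  b : Fin numIneqs → ℝ

namespace LiftedSystem

variable {ι : Type u} [Fintype ι]

/-- The total number of variables, original and additional. -/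
def numVars (F : LiftedSystem ι) : ℕ :=
  Fintype.card ι + F.numAux

/-- The projection of the solution set onto the space of the original variables. -/
def projection (F : LiftedSystem ι) : Set (ι → ℝ) :=
  {x | ∃ y : Fin F.numAux → ℝ, F.A *ᵥ x + F.B *ᵥ y ≤ F.b}

/-- The system is an extended formulation of `P`. -/
def IsExtendedFormulationOf (F : LiftedSystem ι) (P : Set (ι → ℝ)) : Prop :=
  F.projection = P

end LiftedSystem

/-- All coefficients and right-hand side constants are `0`, `1` or `-1`. -/
def LiftedSystem.HasSignData {ι : Type u} (F : LiftedSystem ι) : Prop :=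
  (∀ i j, F.A i j = 0 ∨ F.A i j = 1 ∨ F.A i j = -1) ∧
  (∀ i j, F.B i j = 0 ∨ F.B i j = 1 ∨ F.B i j = -1) ∧
  ∀ i, F.b i = 0 ∨ F.b i = 1 ∨ F.b i = -1

/-- The value at `(m, n)` of a polynomial in two variables with natural coefficients. (On pairs of
natural numbers every real polynomial is bounded above by such a polynomial.) -/
noncomputable def polyValue (p : MvPolynomial (Fin 2) ℕ) (m n : ℕ) : ℕ :=
  MvPolynomial.eval ![m, n] p

/-!
Let `n` be the number of nodes. If every signed edge misses at most `k` nodes, then its product is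
`1` on a face of the cube `{0,1}ⁿ` of dimension at most `k`, that is, at no more than `2 ^ k`
vectors. Hence the set `U` of the vectors at which some product is `1` has at most `2 ^ k |S|`
elements (`SignedHypergraph.card_support_le`), and all products vanish off `U`.

A deterministic automaton that reads a vector coordinate by coordinate needs only `|U| + 1` states
at each position to find out at the end whether the vector lies in `U`, and which element of `U` it
is: it remembers the prefix read so far if this is a prefix of an element of `U`, and otherwise only
that it is not (`prefixAutomaton`). All products can be read off its final state
(`SignedHypergraph.pseudoBooleanSet_eq_range`).

The runs of the automaton are the paths in a layered network with `n + 1` layers of `|U| + 1`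
states and two arcs leaving each state. Every unit flow in this network is a convex combination of
runs: the proportions in which the flow leaves the states are the transition probabilities of a
Markov chain that generates a random input with the given flow
(`BitAutomaton.IsFlow.exists_weights`). Coordinate `i` of the input is the flow on the arcs of
layer `i` labelled `1`, and the value of a product is the flow into certain final states. So the
flow constraints together with these linear equations are an extended formulation
(`BitAutomaton.mem_convexHull_range_point_iff`); its coefficients are `0` and `±1`, and its size is
`O((n + 1) (|U| + 1) + |S|)`.

The polynomial bound follows because `k ≤ c log m` implies `2 ^ k ≤ m ^ N + 1` for `N ≥ c`.
-/

/-! ### Systems in standard form -/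

/-- A system `A x + B y = b`, `y ≥ 0` is a lifted system: every equation becomes two opposite
inequalities, which keeps the data in `{0, 1, -1}`. -/
theorem LiftedSystem.exists_of_standardForm {ι : Type u} [Fintype ι] {E J : Type*} [Fintype E]
    [Fintype J] (A : Matrix E ι ℝ) (B : Matrix E J ℝ) (b : E → ℝ)
    (hA : ∀ i j, A i j = 0 ∨ A i j = 1 ∨ A i j = -1)
    (hB : ∀ i j, B i j = 0 ∨ B i j = 1 ∨ B i j = -1)
    (hb : ∀ i, b i = 0 ∨ b i = 1 ∨ b i = -1) :
    ∃ F : LiftedSystem ι,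
      F.projection = {x | ∃ y : J → ℝ, 0 ≤ y ∧ A *ᵥ x + B *ᵥ y = b} ∧
      F.HasSignData ∧ F.numAux = Fintype.card J ∧
      F.numIneqs = 2 * Fintype.card E + Fintype.card J := by
  classical
  have hneg : ∀ r : ℝ, (r = 0 ∨ r = 1 ∨ r = -1) → (-r = 0 ∨ -r = 1 ∨ -r = -1) := by
    rintro r (rfl | rfl | rfl) <;> simp
  let A' : Matrix (E ⊕ E ⊕ J) ι ℝ := Matrix.fromRows A (Matrix.fromRows (-A) 0)
  let B' : Matrix (E ⊕ E ⊕ J) J ℝ := Matrix.fromRows B (Matrix.fromRows (-B) (-1))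
  let b' : E ⊕ E ⊕ J → ℝ := Sum.elim b (Sum.elim (-b) 0)
  let eJ := Fintype.equivFin J
  let eI := Fintype.equivFin (E ⊕ E ⊕ J)
  have hA' : ∀ i j, A' i j = 0 ∨ A' i j = 1 ∨ A' i j = -1 := by
    rintro (i | i | i) j
    · exact hA i j
    · exact hneg _ (hA i j)
    · exact Or.inl rfl
  have hB' : ∀ i j, B' i j = 0 ∨ B' i j = 1 ∨ B' i j = -1 := by
    rintro (i | i | i) j
    · exact hB i j
    · exact hneg _ (hB i j)
    · have h1 : (1 : Matrix J J ℝ) i j = 0 ∨ (1 : Matrix J J ℝ) i j = 1 ∨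
          (1 : Matrix J J ℝ) i j = -1 := by
        rw [Matrix.one_apply]
        split_ifs <;> simp
      exact hneg _ h1
  have hb' : ∀ i, b' i = 0 ∨ b' i = 1 ∨ b' i = -1 := by
    rintro (i | i | i)
    · exact hb i
    · exact hneg _ (hb i)
    · exact Or.inl rfl
  refine ⟨⟨Fintype.card J, Fintype.card (E ⊕ E ⊕ J), A'.submatrix eI.symm id,
    B'.submatrix eI.symm eJ.symm, b' ∘ eI.symm⟩, ?_, ⟨fun i j => hA' _ _, fun i j => hB' _ _,
      fun i => hb' _⟩, rfl, ?_⟩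
  · have key : ∀ (x : ι → ℝ) (y : J → ℝ),
        A' *ᵥ x + B' *ᵥ y ≤ b' ↔ 0 ≤ y ∧ A *ᵥ x + B *ᵥ y = b := by
      intro x y
      simp only [A', B', b', Matrix.fromRows_mulVec, Pi.le_def, Sum.forall, Pi.add_apply,
        Sum.elim_inl, Sum.elim_inr, Matrix.neg_mulVec, Matrix.one_mulVec, Matrix.zero_mulVec,
        Pi.neg_apply, Pi.zero_apply, funext_iff]
      constructor
      · rintro ⟨h1, h2, h3⟩
        exact ⟨fun j => by linarith [h3 j], fun i => by linarith [h1 i, h2 i]⟩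
      · rintro ⟨h1, h2⟩
        exact ⟨fun i => (h2 i).le, fun i => by linarith [h2 i], fun j => by linarith [h1 j]⟩
    have key' : ∀ (x : ι → ℝ) (y : Fin (Fintype.card J) → ℝ),
        A'.submatrix eI.symm id *ᵥ x + B'.submatrix eI.symm eJ.symm *ᵥ y ≤ b' ∘ eI.symm ↔
          A' *ᵥ x + B' *ᵥ (y ∘ eJ) ≤ b' := by
      intro x y
      have h1 : A'.submatrix eI.symm id *ᵥ x = (A' *ᵥ x) ∘ eI.symm := rfl
      have h2 : B'.submatrix eI.symm eJ.symm *ᵥ y = (B' *ᵥ (y ∘ eJ)) ∘ eI.symm :=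
        Matrix.submatrix_mulVec_equiv _ _ _ _
      rw [h1, h2]
      exact ⟨fun h i => by simpa using h (eI i), fun h i => h (eI.symm i)⟩
    ext x
    simp only [projection, Set.mem_ofPred_eq, key', key]
    constructor
    · rintro ⟨y, hy⟩
      exact ⟨y ∘ eJ, hy⟩
    · rintro ⟨y, hy⟩
      refine ⟨y ∘ eJ.symm, ?_⟩
      rwa [Function.comp_assoc, Equiv.symm_comp_self, Function.comp_id]
  · simp only [Fintype.card_sum]
    ring

/-! ### Automata reading bit vectors -/

/-- A deterministic automaton that reads the coordinates of a vector in `{0,1}ⁿ` one after the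
other; the transition function may depend on the position. -/
structure BitAutomaton (n : ℕ) (Q : Type*) where
  start : Q
  step : Fin n → Q → Bool → Q

namespace BitAutomaton

variable {n : ℕ} {Q : Type*} (M : BitAutomaton n Q)

/-- The state of the automaton before it reads coordinate `i` of `x`; for `i = Fin.last n`, the
final state. -/
def state (x : Fin n → Bool) (i : Fin (n + 1)) : Q :=
  Fin.induction (motive := fun _ => Q) M.start (fun j q => M.step j q (x j)) i

@[simp] theorem state_zero (x : Fin n → Bool) : M.state x 0 = M.start := rfl

@[simp] theorem state_succ (x : Fin n → Bool) (i : Fin n) :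
    M.state x i.succ = M.step i (M.state x i.castSucc) (x i) :=
  Fin.induction_succ ..

theorem state_congr {x y : Fin n → Bool} (i : Fin (n + 1))
    (h : ∀ j : Fin n, j.castSucc < i → x j = y j) : M.state x i = M.state y i := by
  induction i using Fin.induction with
  | zero => rfl
  | succ i ih =>
    rw [state_succ, state_succ, h i Fin.castSucc_lt_succ,
      ih fun j hj => h j (hj.trans Fin.castSucc_lt_succ)]

/-- A unit flow through the layered network of the automaton: `g i q` is the amount that passes
state `q` before position `i`, and `f i q b` the part of it that leaves with the bit `b`. -/
structure IsFlow [Fintype Q] [DecidableEq Q] (g : Fin (n + 1) → Q → ℝ)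
    (f : Fin n → Q → Bool → ℝ) : Prop where
  nonneg : ∀ i q b, 0 ≤ f i q b
  source : ∀ q, g 0 q = if q = M.start then 1 else 0
  outflow : ∀ i q, g i.castSucc q = ∑ b, f i q b
  inflow : ∀ i q, g i.succ q = ∑ p, ∑ b, if M.step i p b = q then f i p b else 0

/-- The unit flow along the run of the automaton on `x`. -/
theorem isFlow_run [Fintype Q] [DecidableEq Q] (x : Fin n → Bool) :
    M.IsFlow (fun i q => if M.state x i = q then 1 else 0)
      (fun i q b => if M.state x i.castSucc = q ∧ x i = b then 1 else 0) where
  nonneg i q b := by positivity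
  source q := by simp [eq_comm]
  outflow i q := by
    by_cases h : M.state x i.castSucc = q <;> simp [h]
  inflow i q := by
    rw [Finset.sum_eq_single (M.state x i.castSucc), Finset.sum_eq_single (x i)]
    · simp
    · intro b _ hb
      simp [hb.symm]
    · simp
    · intro p _ hp
      simp [hp.symm]
    · simp

/-- The outgoing proportions of a flow: transition probabilities of a Markov chain. At a state
without flow they are arbitrary. -/
theorem exists_proportions (f : Bool → ℝ) (hf : ∀ b, 0 ≤ f b) :
    ∃ κ : Bool → ℝ, (∀ b, 0 ≤ κ b) ∧ ∑ b, κ b = 1 ∧ ∀ b, f b = κ b * ∑ b, f b := by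
  by_cases h : ∑ b, f b = 0
  · have h0 : ∀ b, f b = 0 := by
      simpa using (Finset.sum_eq_zero_iff_of_nonneg fun b _ => hf b).1 h
    exact ⟨fun b => if b then 1 else 0, fun b => by positivity, by simp, by simp [h0]⟩
  · refine ⟨fun b => f b / ∑ b, f b, fun b => div_nonneg (hf b) (Finset.sum_nonneg fun b _ => hf b),
      ?_, fun b => (div_mul_cancel₀ _ h).symm⟩
    rw [← Finset.sum_div, div_self h]

/-- Every unit flow is the flow of a probability distribution on the inputs, whose expectation
operator is constructed here position by position: the new operator first draws `x` by the old
one, and then redraws the coordinate `i` with the proportions in which the flow leaves the state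
of `x` before position `i`. -/
theorem IsFlow.exists_expectation [Fintype Q] [DecidableEq Q] {M : BitAutomaton n Q}
    {g : Fin (n + 1) → Q → ℝ} {f : Fin n → Q → Bool → ℝ} (h : M.IsFlow g f) (i : Fin (n + 1)) :
    ∃ E : ((Fin n → Bool) → ℝ) →ₗ[ℝ] ℝ, (∀ F, 0 ≤ F → 0 ≤ E F) ∧ E 1 = 1 ∧
      (∀ j : Fin n, j.castSucc < i → ∀ q b,
        E (fun x => if M.state x j.castSucc = q ∧ x j = b then 1 else 0) = f j q b) ∧
      ∀ q, E (fun x => if M.state x i = q then 1 else 0) = g i q := by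
  induction i using Fin.induction with
  | zero =>
    refine ⟨LinearMap.proj (fun _ => false), fun F hF => hF _, rfl, ?_, fun q => ?_⟩
    · intro j hj
      exact absurd hj (Fin.not_lt_zero _)
    · simp [h.source, eq_comm]
  | succ i ih =>
    obtain ⟨E, hpos, hone, hf, hg⟩ := ih
    choose κ κ_nonneg κ_sum κ_mul using fun q => exists_proportions (f i q) (h.nonneg i q)
    let R : ((Fin n → Bool) → ℝ) →ₗ[ℝ] ((Fin n → Bool) → ℝ) :=
      { toFun := fun F x => ∑ b, κ (M.state x i.castSucc) b * F (Function.update x i b)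
        map_add' := fun F G => by
          ext x
          simp only [Pi.add_apply, mul_add, Finset.sum_add_distrib]
        map_smul' := fun c F => by
          ext x
          simp only [Pi.smul_apply, smul_eq_mul, RingHom.id_apply, Finset.mul_sum]
          exact Finset.sum_congr rfl fun b _ => by ring }
    have hR : ∀ F x, R F x = ∑ b, κ (M.state x i.castSucc) b * F (Function.update x i b) :=
      fun _ _ => rfl
    have hstate : ∀ x b (j : Fin (n + 1)), j ≤ i.castSucc →
        M.state (Function.update x i b) j = M.state x j := by
      intro x b j hj
      refine M.state_congr j fun l hl => Function.update_of_ne ?_ _ _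
      rintro rfl
      exact absurd hl (not_lt.2 hj)
    have harc : ∀ j : Fin n, j.castSucc < i.succ → ∀ q b,
        (E ∘ₗ R) (fun x => if M.state x j.castSucc = q ∧ x j = b then 1 else 0) = f j q b := by
      intro j hj q b
      rw [LinearMap.comp_apply]
      rcases (Fin.castSucc_lt_succ_iff.1 hj).lt_or_eq with hlt | rfl
      · rw [← hf j (Fin.castSucc_lt_castSucc_iff.2 hlt)]
        congr 1
        ext x
        simp only [hR, hstate x _ _ (Fin.castSucc_le_castSucc_iff.2 hlt.le),
          Function.update_of_ne hlt.ne]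
        rw [← Finset.sum_mul, κ_sum, one_mul]
      · have hRF : R (fun x => if M.state x j.castSucc = q ∧ x j = b then 1 else 0) =
            κ q b • fun x => if M.state x j.castSucc = q then 1 else 0 := by
          ext x
          simp only [hR, hstate x _ _ le_rfl, Function.update_self, Pi.smul_apply, smul_eq_mul]
          by_cases hq : M.state x j.castSucc = q <;> simp [hq]
        rw [hRF, map_smul, hg, h.outflow, smul_eq_mul, ← κ_mul]
    refine ⟨E ∘ₗ R, fun F hF => hpos _ fun x => ?_, ?_, harc, fun q => ?_⟩
    · rw [Pi.zero_apply, hR]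
      exact Finset.sum_nonneg fun b _ => mul_nonneg (κ_nonneg _ _) (hF _)
    · have : R 1 = 1 := by
        ext x
        simp only [hR, Pi.one_apply, mul_one, κ_sum]
      rw [LinearMap.comp_apply, this, hone]
    · rw [h.inflow]
      simp only [← harc i Fin.castSucc_lt_succ]
      have hsum : (fun x => if M.state x i.succ = q then (1 : ℝ) else 0) =
          ∑ p, ∑ b, if M.step i p b = q then
            (fun x => if M.state x i.castSucc = p ∧ x i = b then (1 : ℝ) else 0) else 0 := by
        ext x
        simp only [Finset.sum_apply]
        rw [(M.isFlow_run x).inflow i q]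
        refine Finset.sum_congr rfl fun p _ => Finset.sum_congr rfl fun b _ => ?_
        by_cases hs : M.step i p b = q <;> simp [hs]
      rw [hsum]
      simp only [map_sum]
      refine Finset.sum_congr rfl fun p _ => Finset.sum_congr rfl fun b _ => ?_
      split_ifs
      · rfl
      · exact map_zero _

/-- Integrality of the flow polytope: every unit flow is a convex combination of runs. -/
theorem IsFlow.exists_weights [Fintype Q] [DecidableEq Q] {M : BitAutomaton n Q}
    {g : Fin (n + 1) → Q → ℝ} {f : Fin n → Q → Bool → ℝ} (h : M.IsFlow g f) :
    ∃ w : (Fin n → Bool) → ℝ, (∀ x, 0 ≤ w x) ∧ ∑ x, w x = 1 ∧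
      (∀ i q b, f i q b = ∑ x, w x * if M.state x i.castSucc = q ∧ x i = b then 1 else 0) ∧
      ∀ q, g (Fin.last n) q = ∑ x, w x * if M.state x (Fin.last n) = q then 1 else 0 := by
  obtain ⟨E, hpos, hone, hf, hg⟩ := h.exists_expectation (Fin.last n)
  have hE : ∀ F, E F = ∑ x, E (Pi.single x 1) * F x := by
    intro F
    conv_lhs => rw [pi_eq_sum_univ' F]
    simp only [map_sum, map_smul, smul_eq_mul, mul_comm]
  refine ⟨fun x => E (Pi.single x 1), fun x => hpos _ (Pi.single_nonneg.2 zero_le_one), ?_, ?_, ?_⟩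
  · simpa [hone] using (hE 1).symm
  · intro i q b
    rw [← hE, hf i (Fin.castSucc_lt_last i)]
  · intro q
    rw [← hE, hg]

/-- The vector formed by the input `x`, in coordinates `V`, and by the values of the indicator
functions of the sets `acc t` at the final state. -/
def point {V T : Type*} [DecidableEq Q] (e : V ≃ Fin n) (acc : T → Finset Q) (x : Fin n → Bool) :
    V ⊕ T → ℝ :=
  Sum.elim (fun v => if x (e v) then 1 else 0)
    (fun t => if M.state x (Fin.last n) ∈ acc t then 1 else 0)

theorem mem_convexHull_range_point_iff {V T : Type*} [Fintype Q] [DecidableEq Q]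
    (e : V ≃ Fin n) (acc : T → Finset Q) (z : V ⊕ T → ℝ) :
    z ∈ convexHull ℝ (Set.range (M.point e acc)) ↔
      ∃ g f, M.IsFlow g f ∧ (∀ v, z (Sum.inl v) = ∑ q, f (e v) q true) ∧
        ∀ t, z (Sum.inr t) = ∑ q ∈ acc t, g (Fin.last n) q := by
  constructor
  · intro hz
    refine convexHull_min (t := {z | ∃ g f, M.IsFlow g f ∧
      (∀ v, z (Sum.inl v) = ∑ q, f (e v) q true) ∧
        ∀ t, z (Sum.inr t) = ∑ q ∈ acc t, g (Fin.last n) q}) ?_ ?_ hz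
    · rintro _ ⟨x, rfl⟩
      refine ⟨_, _, M.isFlow_run x, fun v => ?_, fun t => ?_⟩
      · by_cases h : x (e v) <;> simp [point, h]
      · simp [point]
    · rintro z₁ ⟨g₁, f₁, h₁, hx₁, hz₁⟩ z₂ ⟨g₂, f₂, h₂, hx₂, hz₂⟩ a b ha hb hab
      refine ⟨a • g₁ + b • g₂, a • f₁ + b • f₂, ⟨fun i q c => ?_, fun q => ?_, fun i q => ?_,
        fun i q => ?_⟩, fun v => ?_, fun t => ?_⟩
      · exact add_nonneg (mul_nonneg ha (h₁.nonneg i q c)) (mul_nonneg hb (h₂.nonneg i q c))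
      · simp only [Pi.add_apply, Pi.smul_apply, smul_eq_mul, h₁.source, h₂.source]
        split_ifs <;> simp [hab]
      · simp only [Pi.add_apply, Pi.smul_apply, smul_eq_mul, h₁.outflow, h₂.outflow,
          Finset.mul_sum, Finset.sum_add_distrib]
      · simp only [Pi.add_apply, Pi.smul_apply, smul_eq_mul, h₁.inflow, h₂.inflow,
          Finset.mul_sum, ← Finset.sum_add_distrib]
        refine Finset.sum_congr rfl fun p _ => Finset.sum_congr rfl fun c _ => ?_
        split_ifs <;> simp
      · simp only [Pi.add_apply, Pi.smul_apply, smul_eq_mul, hx₁, hx₂,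
          Finset.mul_sum, Finset.sum_add_distrib]
      · simp only [Pi.add_apply, Pi.smul_apply, smul_eq_mul, hz₁, hz₂,
          Finset.mul_sum, Finset.sum_add_distrib]
  · rintro ⟨g, f, h, hx, hz⟩
    obtain ⟨w, w_nonneg, w_sum, hf, hg⟩ := h.exists_weights
    have : z = ∑ x, w x • M.point e acc x := by
      ext (v | t)
      · simp only [hx, hf, Finset.sum_apply, Pi.smul_apply, smul_eq_mul]
        rw [Finset.sum_comm]
        refine Finset.sum_congr rfl fun x _ => ?_
        rw [← Finset.mul_sum]
        by_cases h : x (e v) <;> simp [point, h]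
      · simp only [hz, hg, Finset.sum_apply, Pi.smul_apply, smul_eq_mul]
        rw [Finset.sum_comm]
        refine Finset.sum_congr rfl fun x _ => ?_
        rw [← Finset.mul_sum]
        simp [point]
    rw [this]
    exact (convex_convexHull ℝ _).sum_mem (fun x _ => w_nonneg x) w_sum
      fun x _ => subset_convexHull ℝ _ ⟨x, rfl⟩

/-- The flow formulation as a lifted system. -/
theorem exists_liftedSystem {V T : Type u} [Fintype V] [Fintype T] [Fintype Q] [DecidableEq Q]
    (e : V ≃ Fin n) (acc : T → Finset Q) :
    ∃ F : LiftedSystem (V ⊕ T),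
      F.IsExtendedFormulationOf (convexHull ℝ (Set.range (M.point e acc))) ∧
      F.HasSignData ∧
      F.numAux = (n + 1) * Fintype.card Q + n * (Fintype.card Q * 2) ∧
      F.numIneqs = 2 * (Fintype.card Q + n * Fintype.card Q + n * Fintype.card Q + n +
        Fintype.card T) + ((n + 1) * Fintype.card Q + n * (Fintype.card Q * 2)) := by
  classical
  -- The auxiliary variables are `g i q`, on the left, and `f i q b`, on the right.
  let Bsource : Matrix Q ((Fin (n + 1) × Q) ⊕ (Fin n × Q × Bool)) ℝ := fun q =>
    Sum.elim (fun a => if a = (0, q) then 1 else 0) 0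
  let Bout : Matrix (Fin n × Q) ((Fin (n + 1) × Q) ⊕ (Fin n × Q × Bool)) ℝ := fun r =>
    Sum.elim (fun a => if a = (r.1.castSucc, r.2) then 1 else 0)
      (fun a => if a.1 = r.1 then (if a.2.1 = r.2 then -1 else 0) else 0)
  let Bin : Matrix (Fin n × Q) ((Fin (n + 1) × Q) ⊕ (Fin n × Q × Bool)) ℝ := fun r =>
    Sum.elim (fun a => if a = (r.1.succ, r.2) then 1 else 0)
      (fun a => if a.1 = r.1 then (if M.step r.1 a.2.1 a.2.2 = r.2 then -1 else 0) else 0)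
  let Bnode : Matrix V ((Fin (n + 1) × Q) ⊕ (Fin n × Q × Bool)) ℝ := fun v =>
    Sum.elim 0 (fun a => if a.1 = e v then (if a.2.2 = true then -1 else 0) else 0)
  let Bacc : Matrix T ((Fin (n + 1) × Q) ⊕ (Fin n × Q × Bool)) ℝ := fun t =>
    Sum.elim (fun a => if a.1 = Fin.last n then (if a.2 ∈ acc t then -1 else 0) else 0) 0
  let A : Matrix ((Q ⊕ (Fin n × Q) ⊕ (Fin n × Q)) ⊕ (V ⊕ T)) (V ⊕ T) ℝ := Matrix.fromRows 0 1
  let B := Matrix.fromRows (Matrix.fromRows Bsource (Matrix.fromRows Bout Bin))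
    (Matrix.fromRows Bnode Bacc)
  let b : (Q ⊕ (Fin n × Q) ⊕ (Fin n × Q)) ⊕ (V ⊕ T) → ℝ :=
    Sum.elim (Sum.elim (fun q => if q = M.start then 1 else 0) 0) 0
  obtain ⟨F, hF, hsign, hvar, hineq⟩ := LiftedSystem.exists_of_standardForm A B b
    (by
      rintro (i | i) j
      · exact Or.inl rfl
      · by_cases h : i = j <;> simp [A, h])
    (by
      rintro ((i | i | i) | (i | i)) (j | j) <;>
        simp only [B, Matrix.fromRows_apply_inl, Matrix.fromRows_apply_inr] <;>
        simp only [Bsource, Bout, Bin, Bnode, Bacc, Sum.elim_inl, Sum.elim_inr,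
          Pi.zero_apply] <;>
        (try split_ifs) <;> simp)
    (by
      rintro ((i | i) | i)
      · simp only [b, Sum.elim_inl]
        split_ifs <;> simp
      · exact Or.inl rfl
      · exact Or.inl rfl)
  have key : ∀ (z : V ⊕ T → ℝ) (y : (Fin (n + 1) × Q) ⊕ (Fin n × Q × Bool) → ℝ),
      A *ᵥ z + B *ᵥ y = b ↔
      (∀ q, y (Sum.inl (0, q)) = if q = M.start then 1 else 0) ∧
      (∀ i q, y (Sum.inl (Fin.castSucc i, q)) = ∑ c, y (Sum.inr (i, q, c))) ∧
      (∀ i q, y (Sum.inl (Fin.succ i, q)) =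
        ∑ p, ∑ c, if M.step i p c = q then y (Sum.inr (i, p, c)) else 0) ∧
      (∀ v, z (Sum.inl v) = ∑ q, y (Sum.inr (e v, q, true))) ∧
      (∀ t, z (Sum.inr t) = ∑ q ∈ acc t, y (Sum.inl (Fin.last n, q))) := by
    intro z y
    have hsource : ∀ q, (Bsource *ᵥ y) q = y (Sum.inl (0, q)) := by
      intro q
      simp [Bsource, Matrix.mulVec, dotProduct]
    have hout : ∀ r, (Bout *ᵥ y) r =
        y (Sum.inl (r.1.castSucc, r.2)) - ∑ c, y (Sum.inr (r.1, r.2, c)) := by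
      intro r
      simp only [Bout, Matrix.mulVec, dotProduct, Fintype.sum_sum_type, Sum.elim_inl,
        Sum.elim_inr, Fintype.sum_prod_type (α₁ := Fin n), ite_mul, zero_mul, neg_mul, one_mul,
        Finset.sum_ite_eq', Finset.mem_univ, if_true, Fintype.sum_prod_type (α₁ := Q)]
      rw [Finset.sum_eq_single r.1 (by intro i _ hi; simp [hi]) (by simp),
        Finset.sum_eq_single r.2 (by intro i _ hi; simp [hi]) (by simp)]
      simp
      ring
    have hin : ∀ r, (Bin *ᵥ y) r = y (Sum.inl (r.1.succ, r.2)) -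
        ∑ p, ∑ c, if M.step r.1 p c = r.2 then y (Sum.inr (r.1, p, c)) else 0 := by
      intro r
      simp only [Bin, Matrix.mulVec, dotProduct, Fintype.sum_sum_type, Sum.elim_inl,
        Sum.elim_inr, Fintype.sum_prod_type (α₁ := Fin n), ite_mul, zero_mul, neg_mul, one_mul,
        Finset.sum_ite_eq', Finset.mem_univ, if_true, Fintype.sum_prod_type (α₁ := Q)]
      rw [Finset.sum_eq_single r.1 (by intro i _ hi; simp [hi]) (by simp), sub_eq_add_neg,
        ← Finset.sum_neg_distrib]
      congr 1
      refine Finset.sum_congr rfl fun p _ => ?_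
      rw [← Finset.sum_neg_distrib]
      refine Finset.sum_congr rfl fun c _ => ?_
      split_ifs <;> simp_all
    have hnode : ∀ v, (Bnode *ᵥ y) v = -∑ q, y (Sum.inr (e v, q, true)) := by
      intro v
      simp only [Bnode, Matrix.mulVec, dotProduct, Fintype.sum_sum_type, Sum.elim_inl,
        Sum.elim_inr, Fintype.sum_prod_type (α₁ := Fin n), ite_mul, zero_mul, neg_mul, one_mul,
        Fintype.sum_prod_type (α₁ := Q), Pi.zero_apply]
      rw [Finset.sum_eq_single (e v) (by intro i _ hi; simp [hi]) (by simp)]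
      simp
    have hacc : ∀ t, (Bacc *ᵥ y) t = -∑ q ∈ acc t, y (Sum.inl (Fin.last n, q)) := by
      intro t
      simp only [Bacc, Matrix.mulVec, dotProduct, Fintype.sum_sum_type, Sum.elim_inl,
        Sum.elim_inr, Fintype.sum_prod_type (α₁ := Fin (n + 1)), ite_mul, zero_mul, neg_mul,
        one_mul, Pi.zero_apply]
      rw [Finset.sum_eq_single (Fin.last n) (by intro i _ hi; simp [hi]) (by simp)]
      simp [Finset.sum_ite_mem]
    simp only [A, B, b, Matrix.fromRows_mulVec, funext_iff, Sum.forall, Pi.add_apply,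
      Sum.elim_inl, Sum.elim_inr, Matrix.zero_mulVec, Matrix.one_mulVec, Pi.zero_apply, zero_add,
      hsource, hout, hin, hnode, hacc, Prod.forall, and_assoc, sub_eq_zero, ← sub_eq_add_neg]
  refine ⟨F, ?_, hsign, ?_, ?_⟩
  · rw [LiftedSystem.IsExtendedFormulationOf, hF]
    ext z
    rw [mem_convexHull_range_point_iff]
    simp only [Set.mem_ofPred_eq, key]
    constructor
    · rintro ⟨y, hy, h1, h2, h3, h4, h5⟩
      exact ⟨fun i q => y (Sum.inl (i, q)), fun i q c => y (Sum.inr (i, q, c)),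
        ⟨fun i q c => hy _, h1, h2, h3⟩, h4, h5⟩
    · rintro ⟨g, f, h, h4, h5⟩
      refine ⟨Sum.elim (fun a => g a.1 a.2) (fun a => f a.1 a.2.1 a.2.2), ?_,
        h.source, h.outflow, h.inflow, h4, h5⟩
      rintro (⟨i, q⟩ | ⟨i, q, c⟩)
      · change 0 ≤ g i q
        induction i using Fin.cases with
        | zero =>
          rw [h.source]
          positivity
        | succ i =>
          rw [h.inflow]
          refine Finset.sum_nonneg fun p _ => Finset.sum_nonneg fun c _ => ?_
          split_ifs
          · exact h.nonneg _ _ _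
          · exact le_rfl
      · exact h.nonneg i q c
  · rw [hvar]
    simp
  · rw [hineq]
    have : Fintype.card V = n := by simpa using Fintype.card_congr e
    simp only [Fintype.card_sum, Fintype.card_prod, Fintype.card_fin, Fintype.card_bool, this]
    ring

end BitAutomaton

/-! ### Recognizing finitely many bit vectors -/

section PrefixAutomaton

variable {n : ℕ} (U : Finset (Fin n → Bool))

/-- A chosen element that satisfies `P`, or `none` if there is no such element. -/
noncomputable def chooseOption {α : Type*} (P : α → Prop) : Option α :=
  open scoped Classical in if h : ∃ a, P a then some h.choose else none

theorem chooseOption_eq_none_iff {α : Type*} {P : α → Prop} :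
    chooseOption P = none ↔ ∀ a, ¬P a := by
  unfold chooseOption
  split_ifs with h
  · simpa using h
  · simpa using h

theorem of_chooseOption_eq_some {α : Type*} {P : α → Prop} {a : α}
    (h : chooseOption P = some a) : P a := by
  unfold chooseOption at h
  split_ifs at h with hex
  rw [← Option.some_injective _ h]
  exact hex.choose_spec

/-- A chosen element of `U` that agrees with `x` at all positions before `i`, or `none` if there is
no such element. -/
noncomputable def prefixRep (x : Fin n → Bool) (i : Fin (n + 1)) : Option U :=
  chooseOption fun u : U => ∀ j : Fin n, j.castSucc < i → u.1 j = x j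

theorem prefixRep_congr {x y : Fin n → Bool} {i : Fin (n + 1)}
    (h : ∀ j : Fin n, j.castSucc < i → x j = y j) : prefixRep U x i = prefixRep U y i := by
  unfold prefixRep
  -- The choice depends only on the predicate, which is the same for `x` and `y`.
  congr 1
  ext u
  exact forall_congr' fun j => forall_congr' fun hj => by rw [h j hj]

theorem prefixRep_eq_none_iff {x : Fin n → Bool} {i : Fin (n + 1)} :
    prefixRep U x i = none ↔ ∀ u ∈ U, ∃ j : Fin n, j.castSucc < i ∧ u j ≠ x j := by
  simp [prefixRep, chooseOption_eq_none_iff]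

theorem agree_of_prefixRep_eq_some {x : Fin n → Bool} {i : Fin (n + 1)} {u : U}
    (h : prefixRep U x i = some u) : ∀ j : Fin n, j.castSucc < i → u.1 j = x j :=
  of_chooseOption_eq_some h

/-- The automaton that remembers which prefix of an element of `U` has been read, or that the bits
read so far are not such a prefix. A prefix is represented by an element of `U`, so that
`|U| + 1` states suffice. -/
noncomputable def prefixAutomaton : BitAutomaton n (Option U) where
  start := prefixRep U (fun _ => false) 0
  step i q b := q.bind fun u => prefixRep U (Function.update u.1 i b) i.succ

theorem prefixAutomaton_state (x : Fin n → Bool) (i : Fin (n + 1)) :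
    (prefixAutomaton U).state x i = prefixRep U x i := by
  induction i using Fin.induction with
  | zero => exact prefixRep_congr U fun j hj => absurd hj (Fin.not_lt_zero _)
  | succ i ih =>
    rw [BitAutomaton.state_succ, ih]
    cases h : prefixRep U x i.castSucc with
    | none =>
      refine Eq.symm ((prefixRep_eq_none_iff U).2 fun u hu => ?_)
      obtain ⟨j, hj, hne⟩ := (prefixRep_eq_none_iff U).1 h u hu
      exact ⟨j, hj.trans Fin.castSucc_lt_succ, hne⟩
    | some u =>
      refine prefixRep_congr U fun j hj => ?_
      rcases (Fin.castSucc_lt_succ_iff.1 hj).lt_or_eq with hlt | rfl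
      · rw [Function.update_of_ne hlt.ne]
        exact agree_of_prefixRep_eq_some U h j (Fin.castSucc_lt_castSucc_iff.2 hlt)
      · exact Function.update_self ..

theorem prefixAutomaton_state_last_eq_some_iff (x : Fin n → Bool) (u : U) :
    (prefixAutomaton U).state x (Fin.last n) = some u ↔ x = u := by
  rw [prefixAutomaton_state]
  have agree : ∀ {v : U}, prefixRep U x (Fin.last n) = some v → x = v := fun h =>
    funext fun j => (agree_of_prefixRep_eq_some U h j (Fin.castSucc_lt_last j)).symm
  refine ⟨agree, ?_⟩
  rintro rfl
  cases h : prefixRep U u.1 (Fin.last n) with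
  | none =>
    obtain ⟨j, -, hj⟩ := (prefixRep_eq_none_iff U).1 h u u.2
    exact absurd rfl hj
  | some v => rw [Subtype.ext (agree h)]

end PrefixAutomaton

/-! ### Bit vectors satisfying a signed edge -/

/-- The `{0,1}`-vectors at which all factors of the signed edge `s`, and hence its product,
are `1`. -/
def SignedEdge.cube {V : Type u} {n : ℕ} (e : V ≃ Fin n) (s : SignedEdge V) :
    Finset (Fin n → Bool) :=
  Finset.univ.filter fun x => ∀ v : s.nodes, x (e v) = decide (s.sign v = 1)

theorem SignedEdge.mem_cube {V : Type u} {n : ℕ} {e : V ≃ Fin n} {s : SignedEdge V}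
    {x : Fin n → Bool} :
    x ∈ s.cube e ↔ ∀ v : s.nodes, x (e v) = decide (s.sign v = 1) := by
  simp [cube]

theorem SignedEdge.card_cube_le {V : Type u} {n k : ℕ} (e : V ≃ Fin n) (s : SignedEdge V)
    (h : n ≤ s.nodes.card + k) : (s.cube e).card ≤ 2 ^ k := by
  classical
  let free : Finset (Fin n) := (s.nodes.map e.toEmbedding)ᶜ
  have hfree : free.card ≤ k := by
    rw [Finset.card_compl, Finset.card_map, Fintype.card_fin]
    omega
  -- A vector in the cube is determined by its coordinates outside the edge.
  have hinj : Set.InjOn (fun (x : Fin n → Bool) (i : free) => x i) (s.cube e) := by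
    intro x hx y hy hxy
    ext1 i
    by_cases hi : i ∈ free
    · exact congrFun hxy ⟨i, hi⟩
    · obtain ⟨v, hv, rfl⟩ := Finset.mem_map.1 (not_not.1 (mt Finset.mem_compl.2 hi))
      exact (mem_cube.1 hx ⟨v, hv⟩).trans (mem_cube.1 hy ⟨v, hv⟩).symm
  calc (s.cube e).card ≤ (Finset.univ : Finset (free → Bool)).card :=
        Finset.card_le_card_of_injOn _ (fun _ _ => Finset.mem_coe.2 (Finset.mem_univ _)) hinj
    _ = 2 ^ free.card := by simp
    _ ≤ 2 ^ k := Nat.pow_le_pow_right two_pos hfree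

theorem SignedEdge.prod_signedValue {V : Type u} {n : ℕ} (e : V ≃ Fin n) (s : SignedEdge V)
    (x : Fin n → Bool) :
    ∏ v : s.nodes, signedValue (s.sign v) (if x (e v) then 1 else 0) =
      if x ∈ s.cube e then 1 else 0 := by
  have hval : ∀ v : s.nodes, signedValue (s.sign v) (if x (e v) then 1 else 0) =
      if x (e v) = decide (s.sign v = 1) then 1 else 0 := by
    intro v
    by_cases h : s.sign v = 1 <;> by_cases hx : x (e v) <;> simp [signedValue, h, hx]
  simp only [hval, mem_cube]
  split_ifs with h
  · exact Finset.prod_eq_one fun v _ => if_pos (h v)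
  · push Not at h
    obtain ⟨v, hv⟩ := h
    exact Finset.prod_eq_zero (Finset.mem_univ v) (if_neg hv)

/-! ### The pseudo-Boolean polytope -/

/-- The `{0,1}`-vectors at which the product of some signed edge is `1`. -/
noncomputable def SignedHypergraph.support {V : Type u} {n : ℕ} (H : SignedHypergraph V)
    (e : V ≃ Fin n) : Finset (Fin n → Bool) :=
  H.edges.biUnion fun s => s.cube e

theorem SignedHypergraph.card_support_le {V : Type u} {n k : ℕ} (H : SignedHypergraph V)
    (e : V ≃ Fin n) (h : ∀ s ∈ H.edges, n ≤ s.nodes.card + k) :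
    (H.support e).card ≤ 2 ^ k * H.edges.card := by
  rw [mul_comm]
  exact Finset.card_biUnion_le_card_mul _ _ _ fun s hs => s.card_cube_le e (h s hs)

/-- The pseudo-Boolean set consists of the inputs of the prefix automaton of the support, together
with the products, which can be read off the final state. -/
theorem SignedHypergraph.pseudoBooleanSet_eq_range {V : Type u} {n : ℕ}
    (H : SignedHypergraph V) (e : V ≃ Fin n) :
    H.pseudoBooleanSet = Set.range ((prefixAutomaton (H.support e)).point e
      fun s : H.edges => Finset.univ.filter fun q => ∃ u ∈ q, u.1 ∈ s.1.cube e) := by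
  have hpoint : ∀ x (s : H.edges), (prefixAutomaton (H.support e)).point e
      (fun s : H.edges => Finset.univ.filter fun q => ∃ u ∈ q, u.1 ∈ s.1.cube e) x (Sum.inr s) =
      if x ∈ s.1.cube e then 1 else 0 := by
    intro x s
    simp only [BitAutomaton.point, Sum.elim_inr, Finset.mem_filter, Finset.mem_univ, true_and,
      Option.mem_def, prefixAutomaton_state_last_eq_some_iff]
    congr 1
    rw [eq_iff_iff]
    constructor
    · rintro ⟨u, rfl, hu⟩
      exact hu
    · exact fun hx => ⟨⟨x, Finset.mem_biUnion.2 ⟨s, s.2, hx⟩⟩, rfl, hx⟩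
  ext z
  constructor
  · rintro ⟨hbin, hprod⟩
    have hz : ∀ v, (if decide (z (Sum.inl (e.symm (e v))) = 1) = true then (1 : ℝ) else 0) =
        z (Sum.inl v) := by
      intro v
      rcases hbin (Sum.inl v) with h | h <;> simp [h]
    refine ⟨fun i => decide (z (Sum.inl (e.symm i)) = 1), ?_⟩
    ext (v | s)
    · exact hz v
    · rw [hpoint, hprod, ← SignedEdge.prod_signedValue]
      exact Finset.prod_congr rfl fun v _ => by rw [hz]
  · rintro ⟨x, rfl⟩
    refine ⟨?_, fun s => ?_⟩
    · rintro (v | s)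
      · simp only [BitAutomaton.point, Sum.elim_inl]
        split_ifs <;> simp
      · rw [hpoint]
        split_ifs <;> simp
    · rw [hpoint, ← SignedEdge.prod_signedValue]
      rfl

theorem SignedHypergraph.exists_extendedFormulation {V : Type u} [Fintype V]
    (H : SignedHypergraph V) (k : ℕ)
    (h : ∀ s ∈ H.edges, Fintype.card V ≤ s.nodes.card + k) :
    ∃ F : LiftedSystem H.Coord,
      F.IsExtendedFormulationOf H.pseudoBooleanPolytope ∧
      F.HasSignData ∧
      F.numVars ≤ 9 * ((Fintype.card V + 1) * (2 ^ k * H.edges.card + 1)) ∧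
      F.numIneqs ≤ 9 * ((Fintype.card V + 1) * (2 ^ k * H.edges.card + 1)) := by
  let e := Fintype.equivFin V
  obtain ⟨F, hF, hsign, hvar, hineq⟩ := (prefixAutomaton (H.support e)).exists_liftedSystem e
    fun s : H.edges => Finset.univ.filter fun q => ∃ u ∈ q, u.1 ∈ s.1.cube e
  rw [← H.pseudoBooleanSet_eq_range e] at hF
  have hQ : Fintype.card (Option (H.support e)) ≤ 2 ^ k * H.edges.card + 1 := by
    simpa using H.card_support_le e h
  have hS : H.edges.card ≤ 2 ^ k * H.edges.card := Nat.le_mul_of_pos_left _ (by positivity)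
  refine ⟨F, hF, hsign, ?_, ?_⟩
  · rw [LiftedSystem.numVars, hvar, Fintype.card_sum, Fintype.card_coe]
    nlinarith
  · rw [hineq, Fintype.card_coe]
    nlinarith

/-- If `k ≤ c log m`, then `2 ^ k ≤ m ^ N + 1` for every natural number `N ≥ c`; the summand `1`
covers the case `m = 0`, in which `log m = 0`. -/
theorem two_pow_le_of_le_mul_log {c : ℝ} {N k m : ℕ} (hc : c ≤ N)
    (hk : (k : ℝ) ≤ c * Real.log m) : 2 ^ k ≤ m ^ N + 1 := by
  rcases Nat.eq_zero_or_pos m with rfl | hm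
  · have : k = 0 := by
      rw [Nat.cast_zero, Real.log_zero, mul_zero] at hk
      exact_mod_cast le_antisymm hk (Nat.cast_nonneg k)
    simp [this]
  · have hm' : (0 : ℝ) < m := by exact_mod_cast hm
    have hlog : 0 ≤ Real.log m := Real.log_natCast_nonneg m
    have h2 : (2 : ℝ) ≤ Real.exp 1 := by linarith [Real.add_one_le_exp (1 : ℝ)]
    have : (2 : ℝ) ^ k ≤ (m : ℝ) ^ N := calc
      (2 : ℝ) ^ k ≤ Real.exp 1 ^ k := by gcongr
      _ = Real.exp k := by rw [← Real.exp_nat_mul, mul_one]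
      _ ≤ Real.exp (N * Real.log m) :=
        Real.exp_le_exp.2 (hk.trans (mul_le_mul_of_nonneg_right hc hlog))
      _ = (m : ℝ) ^ N := by rw [Real.exp_nat_mul, Real.exp_log hm']
    exact (by exact_mod_cast this : 2 ^ k ≤ m ^ N).trans (Nat.le_succ _)

theorem mainTheorem10 :
    (∃ C : ℕ, ∀ (V : Type u) [Fintype V] (H : SignedHypergraph V) (k : ℕ),
      H.edges.Nonempty →
      (∀ s ∈ H.edges, Fintype.card V ≤ s.nodes.card + k) →
      ∃ F : LiftedSystem H.Coord,
        F.IsExtendedFormulationOf H.pseudoBooleanPolytope ∧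
        F.HasSignData ∧
        F.numVars ≤ C * (2 ^ k * Fintype.card V * H.edges.card) ∧
        F.numIneqs ≤ C * (2 ^ k * Fintype.card V * H.edges.card)) ∧
    (∀ (p : MvPolynomial (Fin 2) ℕ) (c : ℝ), ∃ q : MvPolynomial (Fin 2) ℕ,
      ∀ (V : Type u) [Fintype V] (H : SignedHypergraph V) (k : ℕ),
      (k : ℝ) ≤ c * Real.log (polyValue p (Fintype.card V) H.edges.card) →
      (∀ s ∈ H.edges, Fintype.card V ≤ s.nodes.card + k) →
      ∃ F : LiftedSystem H.Coord,
        F.IsExtendedFormulationOf H.pseudoBooleanPolytope ∧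
        F.HasSignData ∧
        F.numVars ≤ polyValue q (Fintype.card V) H.edges.card ∧
        F.numIneqs ≤ polyValue q (Fintype.card V) H.edges.card) := by
  refine ⟨⟨36, fun V _ H k hne hs => ?_⟩, fun p c => ?_⟩
  · obtain ⟨F, hF, hsign, hvar, hineq⟩ := H.exists_extendedFormulation k hs
    obtain ⟨s, -⟩ := hne.exists_mem
    have hV : 1 ≤ Fintype.card V := by
      have := s.two_le_card.trans s.nodes.card_le_univ
      omega
    have hM : 1 ≤ 2 ^ k * H.edges.card := Nat.mul_pos (by positivity) hne.card_pos
    -- Both factors of the general bound at most double: `a + 1 ≤ 2 * a` for `a ≥ 1`.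
    have hsize : 9 * ((Fintype.card V + 1) * (2 ^ k * H.edges.card + 1)) ≤
        36 * (2 ^ k * Fintype.card V * H.edges.card) := calc
      _ ≤ 9 * ((2 * Fintype.card V) * (2 * (2 ^ k * H.edges.card))) := by
        gcongr <;> omega
      _ = _ := by ring
    exact ⟨F, hF, hsign, hvar.trans hsize, hineq.trans hsize⟩
  · obtain ⟨N, hN⟩ := exists_nat_ge c
    refine ⟨9 * ((MvPolynomial.X 0 + 1) * ((p ^ N + 1) * MvPolynomial.X 1 + 1)),
      fun V _ H k hk hs => ?_⟩
    obtain ⟨F, hF, hsign, hvar, hineq⟩ := H.exists_extendedFormulation k hs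
    have hsize : 9 * ((Fintype.card V + 1) * (2 ^ k * H.edges.card + 1)) ≤
        polyValue (9 * ((MvPolynomial.X 0 + 1) * ((p ^ N + 1) * MvPolynomial.X 1 + 1)))
          (Fintype.card V) H.edges.card := by
      have hq : polyValue (9 * ((MvPolynomial.X 0 + 1) * ((p ^ N + 1) * MvPolynomial.X 1 + 1)))
          (Fintype.card V) H.edges.card = 9 * ((Fintype.card V + 1) *
            ((polyValue p (Fintype.card V) H.edges.card ^ N + 1) * H.edges.card + 1)) := by
        simp [polyValue]
      rw [hq]
      gcongr
      exact two_pow_le_of_le_mul_log hN hk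
    exact ⟨F, hF, hsign, hvar.trans hsize, hineq.trans hsize⟩
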